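/- Let $X$ be a compact metric space that is locally path-connected, and let $\varphi\colon\mathbb R\times X\to X$, $(t,x)\mapsto t\cdot x$, be a continuous flow. Let $C(X)=\{x : t\cdot x=x\ \text{for all } t\in\mathbb R\}$ be the set of critical points, $\omega^{r}(x)=\bigcap_{t\ge 0}\overline{[t,\infty)\cdot x}$ the positive limit set of $x\in X$, and $\Omega^{r}(X)=\bigcup_{x\in X}\omega^{r}(x)$. Let $\varepsilon$ be the family of open sets $E\subseteq X$ such that for every $x\in X$ there is $n\in\mathbb N$ with $(n,\infty)\cdot x\subseteq E$; put $L=\bigcap_{E\in\varepsilon}E$. For $E\in\varepsilon$ let $\pi_0(E)$ be the space of path components of $E$ with the quotient topology and $q_E\colon E\to\pi_0(E)$ the quotient map; let $\check\pi_0=\varprojlim_{E\in\varepsilon}\pi_0(E)$ with the inverse limit topology, with projections $\eta_E\colon\check\pi_0\to\pi_0(E)$, and let $e_0\colon L\to\check\pi_0$ be the map sending $x$ to the family of path components of $x$ in the sets $E$. The completion $\check C_0^{r}(X)$ is the push-out set $X\cup_{L}\check\pi_0$ of $X\hookleftarrow L\xrightarrow{e_0}\check\pi_0$, with canonical maps $p_0\colon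 X\to\check C_0^{r}(X)$ and $i_0\colon\check\pi_0\to\check C_0^{r}(X)$; a set $W$ in it is open if and only if $p_0^{-1}(W)$ and $i_0^{-1}(W)$ are open and for every $a\in i_0^{-1}(W)$ there are $E\in\varepsilon$ and an open $G\subseteq\pi_0(E)$ with $a\in\eta_E^{-1}(G)\subseteq i_0^{-1}(W)$ and $q_E^{-1}(G)\subseteq p_0^{-1}(W)$. The flow is called $\check C_0^{r}$-complete if $p_0$ is a homeomorphism. Then $X$ is $\check C_0^{r}$-complete if and only if $C(X)=\overline{\Omega^{r}(X)}$ and $C(X)$ is a Stone space (compact, Hausdorff and totally disconnected). Moreover, the condition $C(X)=\overline{\Omega^{r}(X)}$ holds if and only if $C(X)$ is the smallest closed global attractor, where a global attractor is an invariant set $M\subseteq X$ such that $\omega^{r}(x)\neq\emptyset$ and $\omega^{r}(x)\subseteq M$ for every $x\in X$. -/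

import Mathlib

open Set Filter Topology

/-- An externology on a topological space: a nonempty family of open sets, closed under finite
intersections and under passing to larger open sets. -/
structure Externology (X : Type*) [TopologicalSpace X] where
  sets : Set (Set X)
  isOpen_of_mem : ∀ E ∈ sets, IsOpen E
  nonempty : sets.Nonempty
  inter_mem : ∀ E ∈ sets, ∀ E' ∈ sets, E ∩ E' ∈ sets
  mem_of_superset : ∀ E ∈ sets, ∀ U, IsOpen U → E ⊆ U → U ∈ sets

namespace ZerothHomotopy

/-- The map on sets of path components induced by a continuous map. -/
def mapOf {Y Z : Type*} [TopologicalSpace Y] [TopologicalSpace Z] (f : Y → Z)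
    (hf : Continuous f) : ZerothHomotopy Y → ZerothHomotopy Z :=
  Quotient.map f fun _ _ h => h.map hf

theorem continuous_mapOf {Y Z : Type*} [TopologicalSpace Y] [TopologicalSpace Z] (f : Y → Z)
    (hf : Continuous f) : Continuous (mapOf f hf) :=
  Continuous.quotient_map' hf _

end ZerothHomotopy

namespace Externology

variable {X : Type*} [TopologicalSpace X] (ε : Externology X)

/-- The limit space `L(X)`: the intersection of all exterior open subsets. -/
def limitSpace : Set X := ⋂₀ ε.sets

/-- The map `π₀(E) → π₀(E')` induced by an inclusion `E ⊆ E'`. -/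
def bond {E E' : Set X} (h : E ⊆ E') : ZerothHomotopy E → ZerothHomotopy E' :=
  ZerothHomotopy.mapOf (inclusion h) (continuous_inclusion h)

/-- The end space: the inverse limit of the spaces `π₀(E)` (path components with the quotient
topology) over the exterior open subsets `E`, with the inverse limit topology. -/
def EndSpace : Type _ :=
  {a : ∀ E : ε.sets, ZerothHomotopy (E : Set X) //
    ∀ (E E' : ε.sets) (h : (E : Set X) ⊆ E'), bond h (a E) = a E'}

instance : TopologicalSpace ε.EndSpace :=
  inferInstanceAs (TopologicalSpace
    {a : ∀ E : ε.sets, ZerothHomotopy (E : Set X) //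
      ∀ (E E' : ε.sets) (h : (E : Set X) ⊆ E'), bond h (a E) = a E'})

/-- The projection `η₀` from the end space to `π₀(E)`. -/
def proj (E : ε.sets) (a : ε.EndSpace) : ZerothHomotopy (E : Set X) := a.1 E

theorem continuous_proj (E : ε.sets) : Continuous (ε.proj E) :=
  (continuous_apply E).comp continuous_subtype_val

theorem bond_proj {E E' : ε.sets} (h : (E : Set X) ⊆ E') (a : ε.EndSpace) :
    bond h (ε.proj E a) = ε.proj E' a := a.2 E E' h

/-- The canonical map `e₀` from the limit space to the end space, sending `x` to the family of
the path components of `x` in the exterior open subsets. -/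
def e₀ (x : ε.limitSpace) : ε.EndSpace :=
  ⟨fun E => ZerothHomotopy.mk ⟨x.1, x.2 E.1 E.2⟩, fun _ _ _ => rfl⟩

/-- The relation on the disjoint union of `X` and the end space that glues `x` to `e₀ x` for each
`x` in the limit space. -/
inductive Glue : X ⊕ ε.EndSpace → X ⊕ ε.EndSpace → Prop
  | glue (x : ε.limitSpace) : Glue (Sum.inl x.1) (Sum.inr (ε.e₀ x))

/-- The underlying set of the completion: the push-out of the inclusion of the limit space in `X`
and of `e₀`. -/
def Completion : Type _ := Quot ε.Glue

/-- The canonical map from `X` to its completion. -/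
def p₀ (x : X) : ε.Completion := Quot.mk _ (Sum.inl x)

/-- The canonical map from the end space to the completion. -/
def in₀ (a : ε.EndSpace) : ε.Completion := Quot.mk _ (Sum.inr a)

/-- The open subsets of the completion: the traces on `X` and on the end space are open, and around
every end `a` of `W` there is an open set `G` of path components of some exterior `E` such that
every end represented in `G` is in `W` and every point of a path component in `G` is in `W`. -/
def IsOpenG₀ (W : Set ε.Completion) : Prop :=
  IsOpen (ε.p₀ ⁻¹' W) ∧ IsOpen (ε.in₀ ⁻¹' W) ∧
    ∀ a ∈ ε.in₀ ⁻¹' W, ∃ E : ε.sets, ∃ G : Set (ZerothHomotopy (E : Set X)), IsOpen G ∧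
      a ∈ ε.proj E ⁻¹' G ∧ ε.proj E ⁻¹' G ⊆ ε.in₀ ⁻¹' W ∧
      ∀ x : (E : Set X), ZerothHomotopy.mk x ∈ G → (x : X) ∈ ε.p₀ ⁻¹' W

instance : TopologicalSpace ε.Completion where
  IsOpen := ε.IsOpenG₀
  isOpen_univ := by
    refine ⟨isOpen_univ, isOpen_univ, fun a _ => ?_⟩
    obtain ⟨E, hE⟩ := ε.nonempty
    exact ⟨⟨E, hE⟩, univ, isOpen_univ, mem_univ _, fun _ _ => mem_univ _, fun _ _ => mem_univ _⟩
  isOpen_inter := by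
    rintro W₁ W₂ ⟨h₁, k₁, l₁⟩ ⟨h₂, k₂, l₂⟩
    refine ⟨h₁.inter h₂, k₁.inter k₂, fun a ha => ?_⟩
    obtain ⟨E₁, G₁, o₁, m₁, s₁, t₁⟩ := l₁ a ha.1
    obtain ⟨E₂, G₂, o₂, m₂, s₂, t₂⟩ := l₂ a ha.2
    let E : ε.sets := ⟨E₁.1 ∩ E₂.1, ε.inter_mem _ E₁.2 _ E₂.2⟩
    have i₁ : (E : Set X) ⊆ E₁ := inter_subset_left
    have i₂ : (E : Set X) ⊆ E₂ := inter_subset_right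
    refine ⟨E, bond i₁ ⁻¹' G₁ ∩ bond i₂ ⁻¹' G₂,
      (o₁.preimage (ZerothHomotopy.continuous_mapOf _ _)).inter
        (o₂.preimage (ZerothHomotopy.continuous_mapOf _ _)), ?_, ?_, ?_⟩
    · constructor
      · change bond i₁ (ε.proj E a) ∈ G₁
        rw [ε.bond_proj i₁ a]
        exact m₁
      · change bond i₂ (ε.proj E a) ∈ G₂
        rw [ε.bond_proj i₂ a]
        exact m₂
    · rintro b ⟨hb₁, hb₂⟩
      change bond i₁ (ε.proj E b) ∈ G₁ at hb₁
      change bond i₂ (ε.proj E b) ∈ G₂ at hb₂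
      rw [ε.bond_proj i₁ b] at hb₁
      rw [ε.bond_proj i₂ b] at hb₂
      exact ⟨s₁ hb₁, s₂ hb₂⟩
    · rintro x ⟨hx₁, hx₂⟩
      exact ⟨t₁ (inclusion i₁ x) hx₁, t₂ (inclusion i₂ x) hx₂⟩
  isOpen_sUnion := by
    intro S hS
    refine ⟨?_, ?_, ?_⟩
    · rw [preimage_sUnion]
      exact isOpen_biUnion fun W hW => (hS W hW).1
    · rw [preimage_sUnion]
      exact isOpen_biUnion fun W hW => (hS W hW).2.1
    · rintro a ⟨W, hW, ha⟩
      obtain ⟨E, G, o, m, s, t⟩ := (hS W hW).2.2 a ha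
      exact ⟨E, G, o, m, fun b hb => ⟨W, hW, s hb⟩, fun x hx => ⟨W, hW, t x hx⟩⟩

/-- The externology on `ℝ` with base the half-lines `(n, ∞)`. -/
def rightReal : Externology ℝ where
  sets := {U | IsOpen U ∧ ∃ n : ℕ, Ioi (n : ℝ) ⊆ U}
  isOpen_of_mem _ h := h.1
  nonempty := ⟨univ, isOpen_univ, 0, subset_univ _⟩
  inter_mem := by
    rintro E ⟨hE, n, hn⟩ E' ⟨hE', m, hm⟩
    refine ⟨hE.inter hE', max n m, fun t ht => ?_⟩
    have ht' : ((max n m : ℕ) : ℝ) < t := ht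
    rw [Nat.cast_max, max_lt_iff] at ht'
    exact ⟨hn ht'.1, hm ht'.2⟩
  mem_of_superset := fun _ hE _ hU h => ⟨hU, hE.2.imp fun _ hn => hn.trans h⟩

end Externology

namespace Flow

variable {X : Type*} [TopologicalSpace X] (φ : Flow ℝ X)

/-- The externology of a flow: the open sets that contain, for every point `x`, the part of the
trajectory of `x` over some `T` in the right externology of `ℝ`. -/
def rightExternology : Externology X where
  sets := {N | IsOpen N ∧ ∀ x, ∃ T ∈ Externology.rightReal.sets, ∀ t ∈ T, φ t x ∈ N}
  isOpen_of_mem _ h := h.1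
  nonempty := ⟨univ, isOpen_univ, fun _ =>
    ⟨univ, ⟨isOpen_univ, 0, subset_univ _⟩, fun _ _ => mem_univ _⟩⟩
  inter_mem := by
    rintro E ⟨hE, h⟩ E' ⟨hE', h'⟩
    refine ⟨hE.inter hE', fun x => ?_⟩
    obtain ⟨T, hT, k⟩ := h x
    obtain ⟨T', hT', k'⟩ := h' x
    exact ⟨T ∩ T', Externology.rightReal.inter_mem T hT T' hT',
      fun t ht => ⟨k t ht.1, k' t ht.2⟩⟩
  mem_of_superset := fun _ hE _ hU h => ⟨hU, fun x =>
    (hE.2 x).imp fun _ hT => ⟨hT.1, fun t ht => h (hT.2 t ht)⟩⟩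

/-- The flow is complete: the canonical map from `X` to the completion of `X` with respect to the
externology of the flow is a homeomorphism. -/
def IsRightComplete : Prop := IsHomeomorph φ.rightExternology.p₀

/-- The set of critical points. -/
def criticalPoints : Set X := {x | ∀ t, φ t x = x}

/-- The positive limit set of a point. -/
def rightLimit (x : X) : Set X := omegaLimit atTop φ {x}

/-- The union of all positive limit sets. -/
def globalRightLimit : Set X := ⋃ x, φ.rightLimit x

/-- The region of attraction of `M`. -/
def regionOfAttraction (M : Set X) : Set X :=
  {x | (φ.rightLimit x).Nonempty ∧ φ.rightLimit x ⊆ M}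

/-- An attractor: an invariant set whose region of attraction is a neighbourhood of it. -/
def IsAttractor (M : Set X) : Prop := IsInvariant φ M ∧ φ.regionOfAttraction M ∈ 𝓝ˢ M

/-- A global attractor: an attractor whose region of attraction is the whole space. -/
def IsGlobalAttractor (M : Set X) : Prop := φ.IsAttractor M ∧ φ.regionOfAttraction M = univ

end Flow

/-- A Stone space: a compact, Hausdorff, totally disconnected space. -/
def IsStoneSpace (Y : Type*) [TopologicalSpace Y] : Prop :=
  CompactSpace Y ∧ T2Space Y ∧ TotallyDisconnectedSpace Y

/-! Completeness amounts to `e₀` being bijective and `p₀` being open. The trajectory of a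
limit-space point stays in every exterior set, so `e₀` is constant along it, and injectivity forces
the limit space to be `C(X)`. Every trajectory determines an end (`exists_end`), represented by some
`c` by surjectivity; openness of `p₀` makes the component of `c` small in a suitable exterior set,
so the trajectory converges to `c`. Local path-connectedness makes each `π₀(E)` discrete, so `C(X)`
injects continuously into a totally disconnected space.

Conversely, if all limit sets lie in `C(X)`, compactness makes the exterior sets exactly the open
neighbourhoods of `C(X)`. When `C(X)` is totally disconnected, such a neighbourhood may be a
disjoint union of two open sets, one of them small around a given point; this confines path
components (`isHomeomorph_p₀`). -/

theorem ZerothHomotopy.mem_of_mk_eq_of_isClopen {Y : Type*} [TopologicalSpace Y] {s : Set Y}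
    (hs : IsClopen s) {x y : Y} (h : ZerothHomotopy.mk x = ZerothHomotopy.mk y) (hx : x ∈ s) :
    y ∈ s := by
  have hxy : Joined x y := Quotient.exact h
  exact hs.connectedComponent_subset hx (pathComponent_subset_component x hxy)

theorem ZerothHomotopy.mem_of_mk_eq_of_disjoint {X : Type*} [TopologicalSpace X] {U V E : Set X}
    (hU : IsOpen U) (hV : IsOpen V) (hUV : Disjoint U V) (hE : E ⊆ U ∪ V) {x y : E}
    (h : ZerothHomotopy.mk x = ZerothHomotopy.mk y) (hx : (x : X) ∈ U) : (y : X) ∈ U := by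
  have hclopen : IsClopen ((↑) ⁻¹' U : Set E) := by
    refine ⟨⟨?_⟩, hU.preimage continuous_subtype_val⟩
    have : ((↑) ⁻¹' U : Set E)ᶜ = (↑) ⁻¹' V := by
      ext z
      exact ⟨fun hz => (hE z.2).resolve_left hz, fun hz hz' => hUV.le_bot ⟨hz', hz⟩⟩
    rw [this]
    exact hV.preimage continuous_subtype_val
  exact mem_of_mk_eq_of_isClopen hclopen h hx

theorem ZerothHomotopy.discreteTopology {Y : Type*} [TopologicalSpace Y]
    [LocallyPathConnectedSpace Y] : DiscreteTopology (ZerothHomotopy Y) := by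
  refine discreteTopology_iff_isOpen_singleton.2 fun a => ?_
  obtain ⟨x, rfl⟩ := mk_surjective a
  rw [← isQuotientMap_mk.isOpen_preimage, preimage_singleton_eq_pathComponent]
  exact IsOpen.pathComponent x

/-- In a closed totally disconnected set `C` of a compact Hausdorff space, every point has
arbitrarily small open neighbourhoods that are split off from the rest of `C`. -/
theorem IsClosed.exists_disjoint_open_cover {X : Type*} [TopologicalSpace X] [T2Space X]
    [CompactSpace X] {C : Set X} (hC : IsClosed C) [TotallyDisconnectedSpace C] {c : X}
    (hc : c ∈ C) {U : Set X} (hU : IsOpen U) (hcU : c ∈ U) :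
    ∃ V W : Set X, IsOpen V ∧ IsOpen W ∧ Disjoint V W ∧ c ∈ V ∧ V ⊆ U ∧ C ⊆ V ∪ W := by
  have : CompactSpace C := isCompact_iff_compactSpace.1 hC.isCompact
  obtain ⟨A, hA, hcA, hAU⟩ := compact_exists_isClopen_in_isOpen (x := (⟨c, hc⟩ : C))
    (hU.preimage continuous_subtype_val) hcU
  have hA' : IsCompact ((↑) '' A : Set X) := hA.1.isCompact.image continuous_subtype_val
  have hB' : IsCompact ((↑) '' Aᶜ : Set X) :=
    hA.compl.1.isCompact.image continuous_subtype_val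
  obtain ⟨V, W, hV, hW, hAV, hBW, hVW⟩ := SeparatedNhds.of_isCompact_isCompact hA' hB'
    ((disjoint_image_iff Subtype.val_injective).2 disjoint_compl_right)
  refine ⟨V ∩ U, W, hV.inter hU, hW, hVW.mono_left inter_subset_left,
    ⟨hAV ⟨_, hcA, rfl⟩, hcU⟩, inter_subset_right, fun x hx => ?_⟩
  by_cases hxA : (⟨x, hx⟩ : C) ∈ A
  · exact Or.inl ⟨hAV ⟨_, hxA, rfl⟩, hAU hxA⟩
  · exact Or.inr (hBW ⟨_, hxA, rfl⟩)

/-! ### Completion of a general externology -/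

namespace Externology

variable {X : Type*} [TopologicalSpace X] (ε : Externology X)

theorem p₀_eq_in₀_e₀ (x : ε.limitSpace) : ε.p₀ x = ε.in₀ (ε.e₀ x) :=
  Quot.sound (Glue.glue x)

theorem p₀_eq_in₀_iff {x : X} {a : ε.EndSpace} :
    ε.p₀ x = ε.in₀ a ↔ ∃ h : x ∈ ε.limitSpace, ε.e₀ ⟨x, h⟩ = a := by
  constructor
  · intro h
    -- A predicate respecting the gluing descends to the push-out and detects the class of `a`.
    let f : ε.Completion → Prop := Quot.lift
      (Sum.elim (fun y => ∃ h : y ∈ ε.limitSpace, ε.e₀ ⟨y, h⟩ = a) (fun b => b = a)) (by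
        rintro _ _ ⟨y⟩
        exact propext ⟨fun ⟨_, h⟩ => h, fun h => ⟨y.2, h⟩⟩)
    have hf : f (ε.in₀ a) := rfl
    rw [← h] at hf
    exact hf
  · rintro ⟨h, rfl⟩
    exact ε.p₀_eq_in₀_e₀ ⟨x, h⟩

theorem p₀_eq_p₀_of_notMem {x y : X} (hx : x ∉ ε.limitSpace) (h : ε.p₀ x = ε.p₀ y) : x = y := by
  let f : ε.Completion → Prop := Quot.lift (Sum.elim (fun z => x = z) (fun _ => False)) (by
    rintro _ _ ⟨z⟩
    exact propext ⟨fun h => hx (h ▸ z.2), False.elim⟩)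
  have hf : f (ε.p₀ x) := rfl
  rw [h] at hf
  exact hf

theorem p₀_injective_iff : Function.Injective ε.p₀ ↔ Function.Injective ε.e₀ := by
  constructor
  · intro h x y hxy
    exact Subtype.ext (h (by rw [p₀_eq_in₀_e₀, p₀_eq_in₀_e₀, hxy]))
  · intro h x y hxy
    by_cases hx : x ∈ ε.limitSpace
    · have hy := hxy.symm.trans (ε.p₀_eq_in₀_e₀ ⟨x, hx⟩)
      obtain ⟨hy, he⟩ := ε.p₀_eq_in₀_iff.1 hy
      exact (congrArg Subtype.val (h he)).symm
    · exact ε.p₀_eq_p₀_of_notMem hx hxy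

theorem p₀_surjective_iff : Function.Surjective ε.p₀ ↔ Function.Surjective ε.e₀ := by
  constructor
  · intro h a
    obtain ⟨x, hx⟩ := h (ε.in₀ a)
    obtain ⟨h, he⟩ := ε.p₀_eq_in₀_iff.1 hx
    exact ⟨_, he⟩
  · rintro h ⟨x | a⟩
    · exact ⟨x, rfl⟩
    · obtain ⟨x, rfl⟩ := h a
      exact ⟨x, ε.p₀_eq_in₀_e₀ x⟩

theorem continuous_p₀ : Continuous ε.p₀ := ⟨fun _ hW => hW.1⟩

theorem continuous_e₀ : Continuous ε.e₀ := by
  refine Continuous.subtype_mk (continuous_pi fun E => ?_) _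
  exact ZerothHomotopy.isQuotientMap_mk.continuous.comp
    (continuous_subtype_val.subtype_mk _)

theorem discreteTopology_zerothHomotopy [LocallyPathConnectedSpace X] (E : ε.sets) :
    DiscreteTopology (ZerothHomotopy (E : Set X)) :=
  have := (ε.isOpen_of_mem E E.2).locallyPathConnectedSpace
  ZerothHomotopy.discreteTopology

theorem totallyDisconnectedSpace_endSpace [LocallyPathConnectedSpace X] :
    TotallyDisconnectedSpace ε.EndSpace := by
  have := ε.discreteTopology_zerothHomotopy
  exact inferInstanceAs (TotallyDisconnectedSpace
    {a : ∀ E : ε.sets, ZerothHomotopy (E : Set X) //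
      ∀ (E E' : ε.sets) (h : (E : Set X) ⊆ E'), bond h (a E) = a E'})

/-- If `p₀` is open and injective, some exterior set has the path component of the limit point `c`
inside a prescribed neighbourhood of `c`. -/
theorem exists_mk_eq_imp_mem (ho : IsOpenMap ε.p₀) (hi : Function.Injective ε.p₀)
    (c : ε.limitSpace) {U : Set X} (hU : IsOpen U) (hc : (c : X) ∈ U) :
    ∃ E : ε.sets, ∀ x : (E : Set X), ZerothHomotopy.mk x = ε.proj E (ε.e₀ c) → (x : X) ∈ U := by
  obtain ⟨-, -, h⟩ : ε.IsOpenG₀ (ε.p₀ '' U) := ho U hU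
  obtain ⟨E, G, -, hcG, -, hG⟩ := h (ε.e₀ c) ⟨c, hc, ε.p₀_eq_in₀_e₀ c⟩
  refine ⟨E, fun x hx => ?_⟩
  obtain ⟨y, hy, hyx⟩ := hG x (hx ▸ hcG)
  exact hi hyx ▸ hy

/-- Discreteness of `π₀(E)` lets the single component of `c` serve as `G`; surjectivity of `e₀` puts
the ends over it in the image of `U`. -/
theorem isOpenMap_p₀ [LocallyPathConnectedSpace X] (hb : Function.Bijective ε.e₀)
    (h : ∀ (c : ε.limitSpace) (U : Set X), IsOpen U → (c : X) ∈ U →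
      ∃ E : ε.sets, ∀ x : (E : Set X), ZerothHomotopy.mk x = ε.proj E (ε.e₀ c) → (x : X) ∈ U) :
    IsOpenMap ε.p₀ := by
  intro U hU
  have hi : Function.Injective ε.p₀ := ε.p₀_injective_iff.2 hb.1
  have key : ∀ a ∈ ε.in₀ ⁻¹' (ε.p₀ '' U), ∃ E : ε.sets,
      ∃ G : Set (ZerothHomotopy (E : Set X)), IsOpen G ∧ a ∈ ε.proj E ⁻¹' G ∧
      ε.proj E ⁻¹' G ⊆ ε.in₀ ⁻¹' (ε.p₀ '' U) ∧
      ∀ x : (E : Set X), ZerothHomotopy.mk x ∈ G → (x : X) ∈ ε.p₀ ⁻¹' (ε.p₀ '' U) := by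
    rintro a ⟨x, hxU, hx⟩
    obtain ⟨hxL, rfl⟩ := ε.p₀_eq_in₀_iff.1 hx
    obtain ⟨E, hE⟩ := h ⟨x, hxL⟩ U hU hxU
    have := ε.discreteTopology_zerothHomotopy E
    refine ⟨E, {ε.proj E (ε.e₀ ⟨x, hxL⟩)}, isOpen_discrete _, rfl, fun b hb' => ?_,
      fun y hy => ⟨y, hE y hy, rfl⟩⟩
    obtain ⟨c, rfl⟩ := hb.2 b
    exact ⟨c, hE ⟨c, c.2 E.1 E.2⟩ hb', ε.p₀_eq_in₀_e₀ c⟩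
  refine ⟨?_, isOpen_iff_forall_mem_open.2 fun a ha => ?_, key⟩
  · rwa [preimage_image_eq _ hi]
  · obtain ⟨E, G, hG, haG, hGU, -⟩ := key a ha
    exact ⟨_, hGU, hG.preimage (ε.continuous_proj E), haG⟩

/-- If the exterior sets are exactly the open neighbourhoods of a closed set, every end is
represented by a point of that set. -/
theorem e₀_surjective [T2Space X] [CompactSpace X] [LocallyPathConnectedSpace X] {C : Set X}
    (hC : IsClosed C) (hε : ∀ E, E ∈ ε.sets ↔ IsOpen E ∧ C ⊆ E) :
    Function.Surjective ε.e₀ := by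
  intro a
  -- `K E` is the component of `E` selected by `a`; a common point of the closures will represent
  -- `a`.
  let K : ε.sets → Set X := fun E =>
    (↑) '' (ZerothHomotopy.mk ⁻¹' {ε.proj E a} : Set (E : Set X))
  have hmono : ∀ {E E' : ε.sets}, (E : Set X) ⊆ E' → K E ⊆ K E' := by
    rintro E E' h _ ⟨x, hx, rfl⟩
    refine ⟨inclusion h x, ?_, rfl⟩
    have hx' : bond h (ZerothHomotopy.mk x) = bond h (ε.proj E a) := congrArg _ hx
    rw [bond_proj] at hx'
    exact hx'
  have hne : Nonempty ε.sets := ε.nonempty.to_subtype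
  obtain ⟨c, hc⟩ : (⋂ E, closure (K E)).Nonempty := by
    refine IsCompact.nonempty_iInter_of_directed_nonempty_isCompact_isClosed _ ?_ ?_
      (fun _ => isClosed_closure.isCompact) (fun _ => isClosed_closure)
    · intro E E'
      exact ⟨⟨_, ε.inter_mem _ E.2 _ E'.2⟩, closure_mono (hmono inter_subset_left),
        closure_mono (hmono inter_subset_right)⟩
    · intro E
      obtain ⟨x, hx⟩ := ZerothHomotopy.mk_surjective (ε.proj E a)
      exact ⟨x, subset_closure ⟨x, hx, rfl⟩⟩
  rw [mem_iInter] at hc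
  have hcC : c ∈ C := by
    by_contra hcC
    obtain ⟨U, V, hU, hV, hCU, hcV, hUV⟩ := SeparatedNhds.of_isCompact_isCompact hC.isCompact
      (isCompact_singleton (x := c)) (disjoint_singleton_right.2 hcC)
    obtain ⟨y, hyV, x, -, rfl⟩ := mem_closure_iff.1 (hc ⟨U, (hε U).2 ⟨hU, hCU⟩⟩) V hV (hcV rfl)
    exact hUV.le_bot ⟨x.2, hyV⟩
  have hcE : ∀ E : ε.sets, c ∈ (E : Set X) := fun E => ((hε E).1 E.2).2 hcC
  refine ⟨⟨c, fun E hE => hcE ⟨E, hE⟩⟩, Subtype.ext (funext fun E => ?_)⟩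
  have hEo := ε.isOpen_of_mem E E.2
  -- The path component of `c` in `E` is open, so it meets `K E` and hence is `K E`.
  obtain ⟨y, hy, x, hx, rfl⟩ := mem_closure_iff.1 (hc E) _ (hEo.pathComponentIn c)
    (mem_pathComponentIn_self (hcE E))
  exact (Quotient.sound (JoinedIn.joined_subtype hy)).trans hx

theorem e₀_injective [T2Space X] [CompactSpace X] {C : Set X}
    (hC : IsClosed C) [TotallyDisconnectedSpace C] (hε : ∀ E, E ∈ ε.sets ↔ IsOpen E ∧ C ⊆ E)
    (hL : ε.limitSpace ⊆ C) : Function.Injective ε.e₀ := by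
  intro x y hxy
  by_contra hne
  have hne' : (x : X) ∈ ({(y : X)}ᶜ : Set X) := fun h => hne (Subtype.ext h)
  obtain ⟨V, W, hV, hW, hVW, hxV, hVy, hCVW⟩ :=
    hC.exists_disjoint_open_cover (hL x.2) isOpen_compl_singleton hne'
  have h := congrArg (ε.proj ⟨V ∪ W, (hε _).2 ⟨hV.union hW, hCVW⟩⟩) hxy
  exact hVy (ZerothHomotopy.mem_of_mk_eq_of_disjoint hV hW hVW subset_rfl h hxV) rfl

/-- The complement of any point outside `C` is exterior. -/
theorem limitSpace_eq [T1Space X] {C : Set X} (hε : ∀ E, E ∈ ε.sets ↔ IsOpen E ∧ C ⊆ E) :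
    ε.limitSpace = C := by
  refine Subset.antisymm (fun x hx => ?_) fun x hx E hE => ((hε E).1 hE).2 hx
  by_contra hxC
  exact hx _ ((hε _).2 ⟨isOpen_compl_singleton (x := x), fun y hy h => hxC (h ▸ hy)⟩) rfl

/-- If the exterior sets are exactly the open neighbourhoods of a closed totally disconnected set,
then the space is complete. -/
theorem isHomeomorph_p₀ [T2Space X] [CompactSpace X] [LocallyPathConnectedSpace X] {C : Set X}
    (hC : IsClosed C) [TotallyDisconnectedSpace C]
    (hε : ∀ E, E ∈ ε.sets ↔ IsOpen E ∧ C ⊆ E) : IsHomeomorph ε.p₀ := by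
  have hL := ε.limitSpace_eq hε
  have hb : Function.Bijective ε.e₀ := ⟨ε.e₀_injective hC hε hL.subset, ε.e₀_surjective hC hε⟩
  refine ⟨ε.continuous_p₀, ε.isOpenMap_p₀ hb fun c U hU hcU => ?_,
    ε.p₀_injective_iff.2 hb.1, ε.p₀_surjective_iff.2 hb.2⟩
  obtain ⟨V, W, hV, hW, hVW, hcV, hVU, hCVW⟩ :=
    hC.exists_disjoint_open_cover (hL.subset c.2) hU hcU
  exact ⟨⟨V ∪ W, (hε _).2 ⟨hV.union hW, hCVW⟩⟩, fun x hx =>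
    hVU (ZerothHomotopy.mem_of_mk_eq_of_disjoint hV hW hVW subset_rfl hx.symm hcV)⟩

end Externology

/-! ### Limit sets, ends of trajectories and attractors of a flow -/

namespace Flow

variable {X : Type*} [TopologicalSpace X] (φ : Flow ℝ X)

theorem mem_rightExternology {E : Set X} :
    E ∈ φ.rightExternology.sets ↔ IsOpen E ∧ ∀ x, ∀ᶠ t in atTop, φ t x ∈ E := by
  refine and_congr_right fun _ => forall_congr' fun x => ⟨?_, fun h => ?_⟩
  · rintro ⟨T, ⟨-, n, hn⟩, hT⟩
    filter_upwards [eventually_gt_atTop (n : ℝ)] with t ht using hT t (hn ht)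
  · obtain ⟨a, ha⟩ := eventually_atTop.1 h
    exact ⟨Ioi (⌈a⌉₊ : ℝ), ⟨isOpen_Ioi, _, subset_rfl⟩,
      fun t ht => ha t ((Nat.le_ceil a).trans (le_of_lt ht))⟩

theorem joinedIn_of_uIcc {E : Set X} {x : X} {s t : ℝ} (h : ∀ r ∈ uIcc s t, φ r x ∈ E) :
    JoinedIn E (φ s x) (φ t x) := by
  have hc : Continuous fun r => φ r x := φ.continuous continuous_id continuous_const
  have hp : IsPathConnected ((fun r => φ r x) '' uIcc s t) :=
    ((convex_uIcc s t).isPathConnected nonempty_uIcc).image hc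
  exact (hp.joinedIn _ ⟨s, left_mem_uIcc, rfl⟩ _ ⟨t, right_mem_uIcc, rfl⟩).mono
    (image_subset_iff.2 h)

theorem mem_rightLimit_iff {x y : X} :
    y ∈ φ.rightLimit x ↔ MapClusterPt y atTop fun t => φ t x :=
  mem_omegaLimit_singleton_iff_mapClusterPt ..

theorem criticalPoints_subset_globalRightLimit : φ.criticalPoints ⊆ φ.globalRightLimit := by
  intro c hc
  refine mem_iUnion.2 ⟨c, φ.mem_rightLimit_iff.2 ?_⟩
  have : (fun t => φ t c) = fun _ => c := funext hc
  rw [this]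
  exact tendsto_const_nhds.mapClusterPt

theorem isInvariant_criticalPoints : IsInvariant φ φ.criticalPoints := by
  intro t x hx
  rwa [hx t]

theorem isClosed_criticalPoints [T2Space X] : IsClosed φ.criticalPoints := by
  have : φ.criticalPoints = ⋂ t, {x | φ t x = x} := by
    ext x
    simp [criticalPoints]
  rw [this]
  exact isClosed_iInter fun t =>
    isClosed_eq (φ.continuous continuous_const continuous_id) continuous_id

theorem criticalPoints_subset_limitSpace : φ.criticalPoints ⊆ φ.rightExternology.limitSpace := by
  intro c hc E hE
  obtain ⟨t, ht⟩ := ((φ.mem_rightExternology.1 hE).2 c).exists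
  rwa [hc t] at ht

/-- Exterior sets pull back to exterior sets under each time map, since this only shifts the entry
times. -/
theorem isInvariant_limitSpace : IsInvariant φ φ.rightExternology.limitSpace := by
  intro t x hx E hE
  obtain ⟨hEo, hE⟩ := φ.mem_rightExternology.1 hE
  refine hx (φ t ⁻¹' E) (φ.mem_rightExternology.2
    ⟨hEo.preimage (φ.continuous continuous_const continuous_id), fun y => ?_⟩)
  filter_upwards [(tendsto_atTop_add_const_left atTop t tendsto_id).eventually (hE y)] with s hs
  rw [mem_preimage, ← φ.map_add]
  exact hs

theorem e₀_flow_eq (x : φ.rightExternology.limitSpace) (t : ℝ) :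
    φ.rightExternology.e₀ ⟨φ t x, φ.isInvariant_limitSpace t x.2⟩ = φ.rightExternology.e₀ x := by
  refine Subtype.ext (funext fun E => Quotient.sound (JoinedIn.joined_subtype ?_))
  have h := φ.joinedIn_of_uIcc (E := E) (x := x) (s := t) (t := 0)
    fun r _ => φ.isInvariant_limitSpace r x.2 E E.2
  rwa [φ.map_zero_apply] at h

theorem limitSpace_eq_criticalPoints (h : Function.Injective φ.rightExternology.e₀) :
    φ.rightExternology.limitSpace = φ.criticalPoints :=
  Subset.antisymm (fun x hx t => congrArg Subtype.val (h (φ.e₀_flow_eq ⟨x, hx⟩ t)))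
    φ.criticalPoints_subset_limitSpace

/-- Every trajectory determines an end. -/
theorem exists_end (x : X) : ∃ a : φ.rightExternology.EndSpace, ∀ E : φ.rightExternology.sets,
    ∀ᶠ t in atTop, ∃ h : φ t x ∈ (E : Set X),
      ZerothHomotopy.mk ⟨φ t x, h⟩ = φ.rightExternology.proj E a := by
  have key : ∀ E : φ.rightExternology.sets, ∃ b : ZerothHomotopy (E : Set X),
      ∀ᶠ t in atTop, ∃ h : φ t x ∈ (E : Set X), ZerothHomotopy.mk ⟨φ t x, h⟩ = b := by
    intro E
    obtain ⟨s, hs⟩ := eventually_atTop.1 ((φ.mem_rightExternology.1 E.2).2 x)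
    refine ⟨.mk ⟨φ s x, hs s le_rfl⟩, ?_⟩
    filter_upwards [eventually_ge_atTop s] with t ht
    refine ⟨hs t ht, Quotient.sound (JoinedIn.joined_subtype (φ.joinedIn_of_uIcc fun r hr => ?_))⟩
    rw [uIcc_of_ge ht] at hr
    exact hs r hr.1
  choose a ha using key
  refine ⟨⟨a, fun E E' h => ?_⟩, ha⟩
  -- One late time computes both components, which gives compatibility.
  obtain ⟨t, ⟨ht, hE⟩, ht', hE'⟩ := ((ha E).and (ha E')).exists
  rw [← hE, ← hE']
  rfl

theorem exists_tendsto_of_isRightComplete (h : φ.IsRightComplete) (x : X) :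
    ∃ c ∈ φ.rightExternology.limitSpace, Tendsto (fun t => φ t x) atTop (𝓝 c) := by
  obtain ⟨a, ha⟩ := φ.exists_end x
  obtain ⟨c, rfl⟩ := φ.rightExternology.p₀_surjective_iff.1 h.surjective a
  refine ⟨c, c.2, tendsto_nhds.2 fun U hU hcU => ?_⟩
  obtain ⟨E, hE⟩ :=
    φ.rightExternology.exists_mk_eq_imp_mem h.isOpenMap h.injective c hU hcU
  filter_upwards [ha E] with t ⟨ht, hmk⟩ using hE _ hmk

theorem rightLimit_subset_singleton [T2Space X] {x c : X}
    (h : Tendsto (fun t => φ t x) atTop (𝓝 c)) : φ.rightLimit x ⊆ {c} := by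
  intro y hy
  have hy' : ClusterPt y (𝓝 c) := ClusterPt.mono (φ.mem_rightLimit_iff.1 hy) h
  exact eq_of_nhds_neBot hy'

/-- A critical point lies in its own limit set and `C(X)` is closed, so only one inclusion matters.
-/
theorem criticalPoints_eq_closure_iff [T2Space X] :
    φ.criticalPoints = closure φ.globalRightLimit ↔ ∀ x, φ.rightLimit x ⊆ φ.criticalPoints := by
  rw [← iUnion_subset_iff]
  exact ⟨fun h => h.symm ▸ subset_closure, fun h => Subset.antisymm
    (φ.criticalPoints_subset_globalRightLimit.trans subset_closure)
    (closure_minimal h φ.isClosed_criticalPoints)⟩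

theorem mem_rightExternology_iff_of_criticalPoints_eq [T2Space X] [CompactSpace X]
    (h : φ.criticalPoints = closure φ.globalRightLimit) (E : Set X) :
    E ∈ φ.rightExternology.sets ↔ IsOpen E ∧ φ.criticalPoints ⊆ E := by
  refine ⟨fun hE => ⟨φ.rightExternology.isOpen_of_mem E hE,
    fun c hc => φ.criticalPoints_subset_limitSpace hc E hE⟩, fun ⟨hEo, hE⟩ => ?_⟩
  refine φ.mem_rightExternology.2 ⟨hEo, fun x => ?_⟩
  have hx := (φ.criticalPoints_eq_closure_iff.1 h x).trans hE
  filter_upwards [eventually_mapsTo_of_isOpen_of_omegaLimit_subset atTop φ {x} hEo hx]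
    with t ht using ht rfl

theorem isRightComplete_iff [T2Space X] [CompactSpace X] [LocallyPathConnectedSpace X] :
    φ.IsRightComplete ↔
      φ.criticalPoints = closure φ.globalRightLimit ∧ IsStoneSpace φ.criticalPoints := by
  constructor
  · intro h
    have hi := φ.rightExternology.p₀_injective_iff.1 h.injective
    have hL := φ.limitSpace_eq_criticalPoints hi
    refine ⟨φ.criticalPoints_eq_closure_iff.2 fun x => ?_,
      isCompact_iff_compactSpace.1 φ.isClosed_criticalPoints.isCompact, inferInstance, ?_⟩
    · obtain ⟨c, hc, hx⟩ := φ.exists_tendsto_of_isRightComplete h x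
      exact (φ.rightLimit_subset_singleton hx).trans (singleton_subset_iff.2 (hL.subset hc))
    · have := φ.rightExternology.totallyDisconnectedSpace_endSpace
      rw [← hL]
      refine ⟨isTotallyDisconnected_of_image φ.rightExternology.continuous_e₀.continuousOn hi
        (isTotallyDisconnected_of_totallyDisconnectedSpace _)⟩
  · rintro ⟨h, -, -, _⟩
    exact φ.rightExternology.isHomeomorph_p₀ φ.isClosed_criticalPoints
      (φ.mem_rightExternology_iff_of_criticalPoints_eq h)

/-- Compactness makes limit sets nonempty, and the neighbourhood condition is automatic once the
region of attraction is everything. -/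
theorem isGlobalAttractor_iff [CompactSpace X] {M : Set X} :
    φ.IsGlobalAttractor M ↔ IsInvariant φ M ∧ ∀ x, φ.rightLimit x ⊆ M := by
  constructor
  · rintro ⟨⟨hM, -⟩, h⟩
    exact ⟨hM, fun x => (h.symm.subset (mem_univ x)).2⟩
  · rintro ⟨hM, h⟩
    have hu : φ.regionOfAttraction M = univ := eq_univ_of_forall fun x =>
      ⟨nonempty_omegaLimit atTop φ {x} (singleton_nonempty x), h x⟩
    exact ⟨⟨hM, hu ▸ univ_mem⟩, hu⟩

theorem criticalPoints_eq_closure_iff_isLeast [T2Space X] [CompactSpace X] :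
    φ.criticalPoints = closure φ.globalRightLimit ↔
      IsLeast {M | IsClosed M ∧ φ.IsGlobalAttractor M} φ.criticalPoints := by
  rw [criticalPoints_eq_closure_iff]
  refine ⟨fun h => ⟨⟨φ.isClosed_criticalPoints, φ.isGlobalAttractor_iff.2
    ⟨φ.isInvariant_criticalPoints, h⟩⟩, ?_⟩, fun h => (φ.isGlobalAttractor_iff.1 h.1.2).2⟩
  rintro M ⟨-, hM⟩
  exact φ.criticalPoints_subset_globalRightLimit.trans
    (iUnion_subset (φ.isGlobalAttractor_iff.1 hM).2)

end Flow

theorem theorem6p6 {X : Type*} [MetricSpace X] [CompactSpace X] [LocallyPathConnectedSpace X]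
    (φ : Flow ℝ X) :
    (φ.IsRightComplete ↔
      φ.criticalPoints = closure φ.globalRightLimit ∧ IsStoneSpace φ.criticalPoints) ∧
    (φ.criticalPoints = closure φ.globalRightLimit ↔
      IsLeast {M | IsClosed M ∧ φ.IsGlobalAttractor M} φ.criticalPoints) :=
  ⟨φ.isRightComplete_iff, φ.criticalPoints_eq_closure_iff_isLeast⟩
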